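/- Let $\Lambda_D(a,x)\in\mathbb Z[a^{\pm1},x^{\pm1}]$ be the Kauffman polynomial of regular isotopy of (nonempty) unoriented link diagrams: the unique regular isotopy invariant with $\Lambda_{\bigcirc}=1$ for the circle without crossings, with $\Lambda_D=a^{\varepsilon}\Lambda_{D'}$ if $D'$ is obtained from $D$ by removing a kink whose crossing has sign $\varepsilon=\pm1$, and with $\Lambda_{L_+}+\Lambda_{L_-}=x(\Lambda_{L_0}+\Lambda_{L_\infty})$. For an oriented diagram $D$ with writhe $w(D)$ let $F_D(a,x)=a^{-w(D)}\Lambda_D(a,x)$. A 5-move replaces two parallel strands of a diagram by five right-handed half-twists. Two unoriented, unframed links are 5-move equivalent if their diagrams are related by a finite sequence of planar isotopies, Reidemeister moves, 5-moves and inverses of these. Put $$v_1^{(5)}(x)=T_4(x),\qquad v_2^{(5)}(a,x)=\sum_{i=1}^{4}T_{i-1}(x)\,a^{i-5},$$ where $T_0=1$, $T_1=x$ and $T_{n+2}=xT_{n+1}-T_n$. **Corollary 3.8.** Let $L_1$, $L_2$ be 5-move equivalent links, given by diagrams. Then the following holds. (i) Let $I$ be the ideal of $\mathbb Z[a^{\pm1},x^{\pm1}]$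 generated by $v_1^{(5)}(x)$ and $v_2^{(5)}(a,x)$. There is $i\in\mathbb Z$ with $\Lambda_{L_1}\equiv a^i\Lambda_{L_2} \bmod I$, and for all orientations of $L_1$ and $L_2$ there is $i\in\mathbb Z$ with $F_{L_1}\equiv a^iF_{L_2}\bmod I$. (ii) Let $a_0,p_0\in\mathbb C$ satisfy $a_0^{10}=1$, $p_0^5=a_0^5$, $a_0\ne p_0,p_0^{-1}$ and $p_0\neq 1,-1,i,-i$ (here $i$ is the imaginary unit), and let $x_0=p_0+p_0^{-1}$. Then for all orientations of $L_1$ and $L_2$ $$\{a_0^jF_{L_1}(a_0,x_0): j\in\mathbb Z\}=\{a_0^jF_{L_2}(a_0,x_0): j\in\mathbb Z\}\quad\text{and}\quad |F_{L_1}(a_0,x_0)|=|F_{L_2}(a_0,x_0)|.$$ (iii) For all orientations of $L_1$ and $L_2$ there is $i\in\mathbb Z$ with $$F_{L_1}(a,a+a^{-1})\equiv a^iF_{L_2}(a,a+a^{-1}) \bmod (5,(a^2-1)^3).$$ Here the substitution $x=a+a^{-1}$ is made in $\mathbb Z[a^{\pm1},(a+a^{-1})^{-1}]$ and the congruence holds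 modulo the ideal generated there; whenever both values lie in $\mathbb Z[a^{\pm1}]$, it holds, with the same $i$, modulo the ideal $(5,(a^2-1)^3)$ of $\mathbb Z[a^{\pm1}]$. -/

import Mathlib

open scoped LaurentPolynomial

noncomputable section

namespace FiveMove

/-! ### Unoriented link diagrams

A link diagram in the plane, put in general position with respect to the height function, is cut by
horizontal lines into slices with a single minimum, maximum or crossing each.  It is recorded as
the list of its slices, read from bottom to top. -/

/-- The four kinds of slices: a local minimum, a local maximum, and the two crossings.
`twistR` is the right-handed half-twist of two vertical strands (the strand running from bottom left
to top right is the overcrossing one), `twistL` is the left-handed one. -/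
inductive Kind
  | cup
  | cap
  | twistR
  | twistL

/-- Number of strands entering the nontrivial part of a slice from below. -/
def Kind.inp : Kind → ℕ
  | .cup => 0
  | .cap => 2
  | .twistR => 2
  | .twistL => 2

/-- Number of strands leaving the nontrivial part of a slice at its top. -/
def Kind.out : Kind → ℕ
  | .cup => 2
  | .cap => 0
  | .twistR => 2
  | .twistL => 2

/-- A slice: its kind and the number of vertical strands to the left of its nontrivial part. -/
structure Slice where
  kind : Kind
  pos : ℕ

/-- A local minimum with `i` strands to its left. -/
abbrev cup (i : ℕ) : Slice := ⟨.cup, i⟩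
/-- A local maximum with `i` strands to its left. -/
abbrev cap (i : ℕ) : Slice := ⟨.cap, i⟩
/-- A right-handed half-twist with `i` strands to its left. -/
abbrev twistR (i : ℕ) : Slice := ⟨.twistR, i⟩
/-- A left-handed half-twist with `i` strands to its left. -/
abbrev twistL (i : ℕ) : Slice := ⟨.twistL, i⟩

/-- `IsTangle n w m`: the slices `w` can be stacked on top of `n` strands, and `m` strands come out
at the top. -/
def IsTangle : ℕ → List Slice → ℕ → Prop
  | n, [], m => n = m
  | n, e :: w, m => e.pos + e.kind.inp ≤ n ∧ IsTangle (n - e.kind.inp + e.kind.out) w m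

/-- Diagrams of (nonempty) unoriented links. -/
def LinkDiagram : Type := {w : List Slice // IsTangle 0 w 0 ∧ w ≠ []}

/-- The slices of a diagram. -/
def LinkDiagram.slices (D : LinkDiagram) : List Slice := D.1

/-- The round circle. -/
def unknot : LinkDiagram := ⟨[cup 0, cap 0], by simp [IsTangle, Kind.inp, Kind.out]⟩

/-! ### Local moves -/

/-- Planar isotopies of diagrams and the second and third Reidemeister moves. -/
inductive RegularMove : List Slice → List Slice → Prop
  /-- Nontrivial parts of two slices which have `d` strands between them pass each other. -/
  | exchange (g h : Kind) (i d : ℕ) :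
      RegularMove [⟨g, i⟩, ⟨h, i + g.out + d⟩] [⟨h, i + g.inp + d⟩, ⟨g, i⟩]
  | zigzagLeft (i : ℕ) : RegularMove [cup i, cap (i + 1)] []
  | zigzagRight (i : ℕ) : RegularMove [cup (i + 1), cap i] []
  /-- A strand crossing one side of a minimum or maximum is moved to its other side. -/
  | slideCupR (i : ℕ) : RegularMove [cup i, twistR (i + 1)] [cup (i + 1), twistL i]
  | slideCupL (i : ℕ) : RegularMove [cup i, twistL (i + 1)] [cup (i + 1), twistR i]
  | slideCapR (i : ℕ) : RegularMove [twistR (i + 1), cap i] [twistL i, cap (i + 1)]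
  | slideCapL (i : ℕ) : RegularMove [twistL (i + 1), cap i] [twistR i, cap (i + 1)]
  | reidemeisterTwoRL (i : ℕ) : RegularMove [twistR i, twistL i] []
  | reidemeisterTwoLR (i : ℕ) : RegularMove [twistL i, twistR i] []
  | reidemeisterThree (i : ℕ) :
      RegularMove [twistR i, twistR (i + 1), twistR i] [twistR (i + 1), twistR i, twistR (i + 1)]

/-- The first Reidemeister move: `Kink r s ε` says that `s` is obtained from `r` by removing a kink
whose crossing has sign `ε`.  (The strands of a kink at a minimum or maximum are antiparallel, so
a right-handed half-twist there is a negative crossing.) -/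
inductive Kink : List Slice → List Slice → ℤ → Prop
  | cupR (i : ℕ) : Kink [cup i, twistR i] [cup i] (-1)
  | cupL (i : ℕ) : Kink [cup i, twistL i] [cup i] 1
  | capR (i : ℕ) : Kink [twistR i, cap i] [cap i] (-1)
  | capL (i : ℕ) : Kink [twistL i, cap i] [cap i] 1

/-- The `k`-move: two parallel strands are replaced by `k` right-handed half-twists. -/
inductive TwistMove (k : ℕ) : List Slice → List Slice → Prop
  | twist (i : ℕ) : TwistMove k [] (List.replicate k (twistR i))

/-- `D'` is obtained from `D` by applying the move `M` to a part of the diagram. -/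
def Local (M : List Slice → List Slice → Prop) (D D' : LinkDiagram) : Prop :=
  ∃ u r s v, M r s ∧ D.slices = u ++ r ++ v ∧ D'.slices = u ++ s ++ v

/-- `k`-move equivalence of unoriented (unframed) links: the equivalence relation on diagrams that is
generated by isotopy (planar isotopy and the three Reidemeister moves) and `k`-moves. -/
def MoveEquivalent (k : ℕ) : LinkDiagram → LinkDiagram → Prop :=
  Relation.EqvGen fun D D' =>
    Local RegularMove D D' ∨ Local (fun r s => ∃ ε, Kink r s ε) D D' ∨ Local (TwistMove k) D D'

/-! ### Orientations and writhe -/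

/-- `Orientation s w t`: an orientation of the tangle `w`, whose strands are directed at the bottom
and at the top as prescribed by `s` and `t` (`true` for upwards, `false` for downwards). -/
inductive Orientation : List Bool → List Slice → List Bool → Type
  | nil (s : List Bool) : Orientation s [] s
  | cup (l r : List Bool) (b : Bool) {w : List Slice} {t : List Bool} :
      Orientation (l ++ b :: (!b) :: r) w t → Orientation (l ++ r) (cup l.length :: w) t
  | cap (l r : List Bool) (b : Bool) {w : List Slice} {t : List Bool} :
      Orientation (l ++ r) w t → Orientation (l ++ b :: (!b) :: r) (cap l.length :: w) t
  | twistR (l r : List Bool) (b c : Bool) {w : List Slice} {t : List Bool} :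
      Orientation (l ++ c :: b :: r) w t → Orientation (l ++ b :: c :: r) (twistR l.length :: w) t
  | twistL (l r : List Bool) (b c : Bool) {w : List Slice} {t : List Bool} :
      Orientation (l ++ c :: b :: r) w t → Orientation (l ++ b :: c :: r) (twistL l.length :: w) t

/-- The writhe: the sum of the signs of all crossings.  A right-handed half-twist is positive if its
two strands are parallel, and negative if they are antiparallel. -/
def Orientation.writhe {s t : List Bool} {w : List Slice} : Orientation s w t → ℤ
  | .nil _ => 0
  | .cup _ _ _ o => o.writhe
  | .cap _ _ _ o => o.writhe
  | .twistR _ _ b c o => (if b = c then 1 else -1) + o.writhe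
  | .twistL _ _ b c o => (if b = c then -1 else 1) + o.writhe

/-- An orientation of a link diagram. -/
abbrev LinkDiagram.Orientation (D : LinkDiagram) : Type := FiveMove.Orientation [] D.slices []

/-! ### The Kauffman polynomial -/

/-- The ring `ℤ[a^{±1}, x^{±1}]`, as Laurent polynomials in `x` over Laurent polynomials in `a`. -/
abbrev KRing : Type := ℤ[T;T⁻¹][T;T⁻¹]

/-- The monomial `a ^ i`. -/
def aPow (i : ℤ) : KRing := LaurentPolynomial.C (LaurentPolynomial.T i)

/-- The variable `x`. -/
def xVar : KRing := LaurentPolynomial.T 1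

/-- The defining properties of the Kauffman polynomial of regular isotopy. -/
structure IsKauffman (Λ : LinkDiagram → KRing) : Prop where
  regular : ∀ D D' : LinkDiagram, Local RegularMove D D' → Λ D = Λ D'
  initial : Λ unknot = 1
  framing : ∀ (ε : ℤ) (D D' : LinkDiagram), Local (fun r s => Kink r s ε) D D' →
    Λ D = aPow ε * Λ D'
  skein : ∀ (u v : List Slice) (i : ℕ) (Dp Dm D0 Dinf : LinkDiagram),
    Dp.slices = u ++ [twistR i] ++ v → Dm.slices = u ++ [twistL i] ++ v →
    D0.slices = u ++ v → Dinf.slices = u ++ [cap i, cup i] ++ v →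
    Λ Dp + Λ Dm = xVar * (Λ D0 + Λ Dinf)

open Classical in
/-- The Kauffman polynomial `Λ_D(a, x)` of regular isotopy: the unique function on diagrams with the
properties `IsKauffman`.  That there is exactly one such function is Kauffman's theorem; a value for
the other case has to be given only because this theorem is not part of the library. -/
def Lam : LinkDiagram → KRing :=
  if h : ∃! Λ : LinkDiagram → KRing, IsKauffman Λ then h.choose else 0

/-- The Kauffman polynomial `F(a, x) = a ^ (-w) Λ(a, x)` of an oriented diagram. -/
def F {D : LinkDiagram} (o : D.Orientation) : KRing := aPow (-o.writhe) * Lam D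

/-! ### The ideal generated by `v₁` and `v₂` -/

/-- The shifted Chebyshev polynomial `T_n(x)`, with `T_0 = 1`, `T_1 = x`,
`T_{n+2} = x T_{n+1} - T_n`. -/
def cheb (n : ℤ) : KRing := Polynomial.aeval xVar (Polynomial.Chebyshev.S ℤ n)

/-- `v₁^{(k)}(x) = T_{k-1}(x)`, which is `(p^k - p^{-k}) / (p - p^{-1})` for `x = p + p^{-1}`. -/
def v1 (k : ℕ) : KRing := cheb ((k : ℤ) - 1)

/-- `v₂^{(k)}(a, x) = ∑_{i=1}^{k-1} T_{i-1}(x) a^{i-k}`. -/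
def v2 (k : ℕ) : KRing :=
  ∑ i ∈ Finset.Icc 1 (k - 1), cheb ((i : ℤ) - 1) * aPow ((i : ℤ) - (k : ℤ))

/-- The ideal of `ℤ[a^{±1}, x^{±1}]` generated by `v₁^{(k)}` and `v₂^{(k)}`. -/
def vIdeal (k : ℕ) : Ideal KRing := Ideal.span {v1 k, v2 k}

/-! ### Substitutions -/

/-- The value `P(a₀, x₀)` at nonzero complex numbers. -/
def evalC (a₀ x₀ : ℂ) (ha : a₀ ≠ 0) (hx : x₀ ≠ 0) : KRing →+* ℂ :=
  LaurentPolynomial.eval₂ (LaurentPolynomial.eval₂ (Int.castRingHom ℂ) (Units.mk0 a₀ ha))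
    (Units.mk0 x₀ hx)

theorem ne_zero_of_pow_ten {a₀ : ℂ} (h : a₀ ^ 10 = 1) : a₀ ≠ 0 := by
  rintro rfl; norm_num at h

theorem add_inv_ne_zero {a₀ p₀ : ℂ} (h : a₀ ^ 10 = 1) (hp : p₀ ^ 5 = a₀ ^ 5)
    (h1 : p₀ ≠ Complex.I) (h2 : p₀ ≠ -Complex.I) : p₀ + p₀⁻¹ ≠ 0 := by
  have h0 : p₀ ≠ 0 := by
    rintro rfl
    have : a₀ ^ 5 = 0 := by simpa using hp.symm
    exact ne_zero_of_pow_ten h (by simpa using this)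
  intro hs
  have hm : (p₀ - Complex.I) * (p₀ + Complex.I) = 0 := by
    field_simp at hs
    linear_combination hs - Complex.I_sq
  rcases mul_eq_zero.1 hm with h' | h'
  · exact h1 (sub_eq_zero.1 h')
  · exact h2 (eq_neg_of_add_eq_zero_left h')

/-- The ring `ℤ[a^{±1}, (a + a^{-1})^{-1}]`, in which `x^{±1}` can be replaced by
`(a + a^{-1})^{±1}`. -/
abbrev ARing : Type :=
  Localization.Away (LaurentPolynomial.T 1 + LaurentPolynomial.T (-1) : ℤ[T;T⁻¹])

/-- The substitution `P(a, x) ↦ P(a, a + a^{-1})`. -/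
def substX : KRing →+* ARing :=
  LaurentPolynomial.eval₂ (algebraMap ℤ[T;T⁻¹] ARing)
    (IsLocalization.Away.algebraMap_isUnit (S := ARing)
      (LaurentPolynomial.T 1 + LaurentPolynomial.T (-1) : ℤ[T;T⁻¹])).unit

/-- The ideal `(5, (a^2 - 1)^3)` of `ℤ[a^{±1}]`. -/
def fiveIdeal : Ideal ℤ[T;T⁻¹] := Ideal.span {5, (LaurentPolynomial.T 2 - 1) ^ 3}

end FiveMove

end

open FiveMove

namespace FiveMove

/-! ### Tangles -/

/-! Put n right-handed half-twists in place of the two strands and let f(n) be the value of Λ. The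
skein relation at the topmost crossing expresses f(n+2) through f(n+1), f(n) and a diagram with n+1
kinks below a maximum, each worth a⁻¹. So f satisfies a linear recursion with characteristic
polynomial t² - xt + 1 and forcing terms proportional to powers of a⁻¹. Solving it gives f(5) ≡ a⁻⁵
f(0) modulo v₁ and v₂ (`sub_mem_vIdeal_of_recurrence`, `IsKauffman.fiveMove`). Reidemeister moves
change Λ at most by a power of a, which proves (i).

Parts (ii) and (iii) follow once the substitutions are seen to send v₁ and v₂ to 0, respectively
into the ideal (5, (a² - 1)³): `vIdeal_le_ker_evalC`, `vIdeal_le_comap_substX`. To return from the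
localization to Laurent polynomials in a, one uses that a + a⁻¹ is already a unit modulo this ideal.
-/

theorem isTangle_append {u v : List Slice} {n m : ℕ} :
    IsTangle n (u ++ v) m ↔ ∃ k, IsTangle n u k ∧ IsTangle k v m := by
  induction u generalizing n with
  | nil => simp [IsTangle]
  | cons e u ih => simp [IsTangle, ih, and_assoc]

theorem isTangle_replicate_twistR {i k : ℕ} (h : i + 2 ≤ k) (n : ℕ) :
    IsTangle k (List.replicate n (twistR i)) k := by
  induction n with
  | zero => simp [IsTangle]
  | succ n ih =>
    rw [List.replicate_succ]
    refine ⟨h, ?_⟩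
    rwa [show k - Kind.twistR.inp + Kind.twistR.out = k by simp only [Kind.inp, Kind.out]; omega]

theorem IsTangle.unique {w : List Slice} {n m m' : ℕ} (h : IsTangle n w m)
    (h' : IsTangle n w m') : m = m' := by
  induction w generalizing n with
  | nil => exact h.symm.trans h'
  | cons e w ih => exact ih h.2 h'.2

/-! ### The ring `ℤ[a^{±1}, x^{±1}]` -/

theorem aPow_add (i j : ℤ) : aPow (i + j) = aPow i * aPow j := by
  simp only [aPow, LaurentPolynomial.T_add, map_mul]

theorem aPow_zero : aPow 0 = 1 := by
  simp only [aPow, LaurentPolynomial.T_zero, map_one]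

theorem aPow_mul_aPow_neg (i : ℤ) : aPow i * aPow (-i) = 1 := by
  rw [← aPow_add, add_neg_cancel, aPow_zero]

theorem aPow_neg_natCast (n : ℕ) : aPow (-n) = aPow (-1) ^ n := by
  induction n with
  | zero => simp [aPow_zero]
  | succ n ih => rw [pow_succ, ← ih, ← aPow_add]; congr 1; push_cast; ring

theorem cheb_add_two (n : ℤ) : cheb (n + 2) = xVar * cheb (n + 1) - cheb n := by
  simp only [cheb, Polynomial.Chebyshev.S_add_two, map_sub, map_mul, Polynomial.aeval_X]

theorem cheb_zero : cheb 0 = 1 := by simp [cheb]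

theorem cheb_one : cheb 1 = xVar := by simp [cheb]

theorem cheb_two : cheb 2 = xVar ^ 2 - 1 := by
  have h := cheb_add_two 0
  norm_num [cheb_zero, cheb_one] at h
  rw [h]; ring

theorem cheb_three : cheb 3 = xVar ^ 3 - 2 * xVar := by
  have h := cheb_add_two 1
  norm_num [cheb_two, cheb_one] at h
  rw [h]; ring

theorem cheb_four : cheb 4 = xVar ^ 4 - 3 * xVar ^ 2 + 1 := by
  have h := cheb_add_two 2
  norm_num [cheb_two, cheb_three] at h
  rw [h]; ring

theorem v1_five : v1 5 = xVar ^ 4 - 3 * xVar ^ 2 + 1 := by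
  rw [← cheb_four, v1]; norm_num

theorem v2_five : v2 5 = aPow (-1) ^ 4 + xVar * aPow (-1) ^ 3 + (xVar ^ 2 - 1) * aPow (-1) ^ 2 +
    (xVar ^ 3 - 2 * xVar) * aPow (-1) := by
  rw [v2, show Finset.Icc 1 (5 - 1) = ({1, 2, 3, 4} : Finset ℕ) by decide]
  simp [cheb_zero, cheb_one, cheb_two, cheb_three, ← aPow_neg_natCast]
  ring

theorem v1_mem : v1 5 ∈ vIdeal 5 := Ideal.subset_span (by simp)

theorem v2_mem : v2 5 ∈ vIdeal 5 := Ideal.subset_span (by simp)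

/-- Solution of the recursion for inserting half-twists, modulo `v₁` and `v₂`. -/
theorem sub_mem_vIdeal_of_recurrence {f : ℕ → KRing} {c : KRing}
    (h : ∀ n : ℕ, f (n + 2) + f n = xVar * (f (n + 1) + aPow (-1) ^ (n + 1) * c)) :
    f 5 - aPow (-5) * f 0 ∈ vIdeal 5 := by
  -- The sequence g(n) = f(n) - a⁻ⁿ f(0) has g(0) = 0 and g(n+2) - x g(n+1) + g(n) = a⁻⁽ⁿ⁺¹⁾ d with
  -- d = xc - (a⁻¹ - x + a) f(0). Hence g(5) = g(1) T₄ + d ∑ T₃₋ₙ a⁻⁽ⁿ⁺¹⁾ over 0 ≤ n ≤ 3, and the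
  -- sum is v₂.
  have key : f 5 - aPow (-5) * f 0 =
      (f 1 - aPow (-1) * f 0) * v1 5 +
        (xVar * c - (aPow (-1) - xVar + aPow 1) * f 0) * v2 5 := by
    have h5 := aPow_neg_natCast 5
    push_cast at h5
    rw [h5, v1_five, v2_five]
    linear_combination h 3 + xVar * h 2 + (xVar ^ 2 - 1) * h 1 + (xVar ^ 3 - 2 * xVar) * h 0 +
      f 0 * (aPow (-1) ^ 3 + xVar * aPow (-1) ^ 2 + (xVar ^ 2 - 1) * aPow (-1) +
        (xVar ^ 3 - 2 * xVar)) * aPow_mul_aPow_neg 1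
  rw [key]
  exact add_mem (Ideal.mul_mem_left _ _ v1_mem) (Ideal.mul_mem_left _ _ v2_mem)

/-! ### Congruence up to powers of `a` -/

/-- Congruence modulo `I` up to multiplication by a power of `a`. -/
def CongrUpToPow (I : Ideal KRing) (P Q : KRing) : Prop :=
  ∃ i : ℤ, P - aPow i * Q ∈ I

namespace CongrUpToPow

variable {I : Ideal KRing} {P Q R : KRing}

theorem of_eq_mul (i : ℤ) (h : P = aPow i * Q) : CongrUpToPow I P Q :=
  ⟨i, by rw [h, sub_self]; exact zero_mem _⟩

theorem symm (h : CongrUpToPow I P Q) : CongrUpToPow I Q P := by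
  obtain ⟨i, hi⟩ := h
  refine ⟨-i, ?_⟩
  rw [show Q - aPow (-i) * P = -aPow (-i) * (P - aPow i * Q) by
    linear_combination -Q * aPow_mul_aPow_neg i]
  exact Ideal.mul_mem_left _ _ hi

theorem trans (h : CongrUpToPow I P Q) (h' : CongrUpToPow I Q R) : CongrUpToPow I P R := by
  obtain ⟨i, hi⟩ := h
  obtain ⟨j, hj⟩ := h'
  refine ⟨i + j, ?_⟩
  rw [show P - aPow (i + j) * R = (P - aPow i * Q) + aPow i * (Q - aPow j * R) by
    rw [aPow_add]; ring]
  exact add_mem hi (Ideal.mul_mem_left _ _ hj)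

theorem aPow_mul (h : CongrUpToPow I P Q) (m n : ℤ) :
    CongrUpToPow I (aPow m * P) (aPow n * Q) :=
  ((of_eq_mul m rfl).trans h).trans (of_eq_mul n rfl).symm

end CongrUpToPow

/-! ### Invariance of the Kauffman polynomial -/

namespace IsKauffman

variable {Λ : LinkDiagram → KRing}

/-- Kinks below a maximum can be removed one after the other. -/
theorem twists_cap (hΛ : IsKauffman Λ) (u v : List Slice) (i : ℕ) (E : ℕ → LinkDiagram)
    (hE : ∀ n, (E n).slices = u ++ List.replicate n (twistR i) ++ [cap i] ++ v) (n : ℕ) :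
    Λ (E n) = aPow (-1) ^ n * Λ (E 0) := by
  induction n with
  | zero => simp
  | succ n ih =>
    rw [hΛ.framing (-1) (E (n + 1)) (E n)
      ⟨u ++ List.replicate n (twistR i), _, _, v, Kink.capR i, ?_, hE n⟩, ih]
    · ring
    · simp [hE, List.replicate_succ']

/-- The skein relation at the topmost crossing of a row of half-twists. -/
theorem twists_add_two (hΛ : IsKauffman Λ) (u v : List Slice) (i : ℕ) (A B E : ℕ → LinkDiagram)
    (hA : ∀ n, (A n).slices = u ++ List.replicate n (twistR i) ++ v)
    (hB : ∀ n, (B n).slices = u ++ List.replicate n (twistR i) ++ twistL i :: v)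
    (hE : ∀ n, (E n).slices = u ++ List.replicate n (twistR i) ++ cap i :: cup i :: v) (n : ℕ) :
    Λ (A (n + 2)) + Λ (A n) = xVar * (Λ (A (n + 1)) + aPow (-1) ^ (n + 1) * Λ (E 0)) := by
  -- Switching the topmost of n + 2 crossings lets it cancel with the one below, leaving n. One
  -- smoothing leaves n + 1 half-twists, the other caps them off, turning them into kinks.
  rw [← hΛ.twists_cap u (cup i :: v) i E (fun n => by simp [hE]) (n + 1),
    ← hΛ.regular (B (n + 1)) (A n) ⟨u ++ List.replicate n (twistR i), _, _, v,
      .reidemeisterTwoRL i, by simp [hB, List.replicate_succ'], by simp [hA]⟩]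
  exact hΛ.skein (u ++ List.replicate (n + 1) (twistR i)) v i _ _ _ _
    (by simp [hA, List.replicate_succ']) (by simp [hB]) (by simp [hA]) (by simp [hE])

theorem fiveMove (hΛ : IsKauffman Λ) {D D' : LinkDiagram} (h : Local (TwistMove 5) D D') :
    CongrUpToPow (vIdeal 5) (Λ D') (Λ D) := by
  obtain ⟨u, _, _, v, ⟨i⟩, hD, hD'⟩ := h
  -- Only the twisted side of the move shows that strands i and i + 1 exist at this height; the
  -- other side inserts nothing there.
  have ht : IsTangle 0 (u ++ List.replicate 5 (twistR i) ++ v) 0 := hD' ▸ D'.2.1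
  have hne : u ++ v ≠ [] := fun hn => D.2.2 (by rw [List.append_nil, hn] at hD; exact hD)
  rw [List.append_assoc, isTangle_append] at ht
  obtain ⟨k, hu, hr⟩ := ht
  have hk : i + 2 ≤ k := hr.1
  obtain ⟨l, hl, hv⟩ := isTangle_append.1 hr
  obtain rfl := hl.unique (isTangle_replicate_twistR hk 5)
  have hT (n : ℕ) {w : List Slice} (hw : IsTangle l w 0) :
      IsTangle 0 (u ++ List.replicate n (twistR i) ++ w) 0 := by
    rw [List.append_assoc]
    exact isTangle_append.2 ⟨l, hu, isTangle_append.2 ⟨l, isTangle_replicate_twistR hk n, hw⟩⟩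
  have hcap : IsTangle l (cap i :: cup i :: v) 0 :=
    ⟨hk, by simp only [Kind.inp, Kind.out]; omega, by
      simpa only [Kind.inp, Kind.out, show l - 2 + 0 - 0 + 2 = l by omega] using hv⟩
  have htwist : IsTangle l (twistL i :: v) 0 :=
    ⟨hk, by simpa only [Kind.inp, Kind.out, show l - 2 + 2 = l by omega] using hv⟩
  have hdiag (n : ℕ) (w : List Slice) (hw : IsTangle l w 0) (hn : u ++ w ≠ []) :
      ∃ D : LinkDiagram, D.slices = u ++ List.replicate n (twistR i) ++ w :=
    ⟨⟨_, hT n hw, fun h => hn (by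
      simp only [List.append_eq_nil_iff] at h ⊢; exact ⟨h.1.1, h.2⟩)⟩, rfl⟩
  choose A hA using fun n => hdiag n v hv hne
  choose B hB using fun n => hdiag n _ htwist (by simp)
  choose E hE using fun n => hdiag n _ hcap (by simp)
  have hD0 : D = A 0 := Subtype.ext (hD.trans (hA 0).symm)
  have hD5 : D' = A 5 := Subtype.ext (hD'.trans (hA 5).symm)
  rw [hD0, hD5]
  exact ⟨-5, sub_mem_vIdeal_of_recurrence (f := fun n => Λ (A n))
    (hΛ.twists_add_two u v i A B E hA hB hE)⟩

theorem moveEquivalent (hΛ : IsKauffman Λ) {D₁ D₂ : LinkDiagram} (h : MoveEquivalent 5 D₁ D₂) :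
    CongrUpToPow (vIdeal 5) (Λ D₁) (Λ D₂) := by
  induction h with
  | rel D D' h =>
    rcases h with h | ⟨u, r, s, v, ⟨ε, hk⟩, h⟩ | h
    · exact .of_eq_mul 0 (by rw [aPow_zero, one_mul, hΛ.regular D D' h])
    · exact .of_eq_mul ε (hΛ.framing ε D D' ⟨u, r, s, v, hk, h⟩)
    · exact (hΛ.fiveMove h).symm
  | refl D => exact .of_eq_mul 0 (by rw [aPow_zero, one_mul])
  | symm _ _ _ ih => exact ih.symm
  | trans _ _ _ _ _ ih ih' => exact ih.trans ih'

end IsKauffman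

theorem lam_congr {D₁ D₂ : LinkDiagram} (h : MoveEquivalent 5 D₁ D₂) :
    CongrUpToPow (vIdeal 5) (Lam D₁) (Lam D₂) := by
  by_cases hΛ : ∃! Λ : LinkDiagram → KRing, IsKauffman Λ
  · rw [Lam, dif_pos hΛ]
    exact hΛ.choose_spec.1.moveEquivalent h
  -- Here `Lam` takes its default value 0, for which the congruence is trivial.
  · rw [Lam, dif_neg hΛ]
    exact .of_eq_mul 0 (by simp)

/-- The writhes contribute only powers of a, so the orientations need not be related. -/
theorem F_congr {D₁ D₂ : LinkDiagram} (h : MoveEquivalent 5 D₁ D₂)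
    (o₁ : D₁.Orientation) (o₂ : D₂.Orientation) :
    CongrUpToPow (vIdeal 5) (F o₁) (F o₂) :=
  (lam_congr h).aPow_mul _ _

/-! ### Evaluation at complex numbers -/

section evalC

variable {a₀ x₀ : ℂ} (ha : a₀ ≠ 0) (hx : x₀ ≠ 0)

theorem evalC_aPow (i : ℤ) : evalC a₀ x₀ ha hx (aPow i) = a₀ ^ i := by
  simp [evalC, aPow]

theorem evalC_xVar : evalC a₀ x₀ ha hx xVar = x₀ := by
  simp [evalC, xVar]

end evalC

/-- From Tₙ = (pⁿ⁺¹ - p⁻ⁿ⁻¹)/(p - p⁻¹) and p¹⁰ = 1 one gets T₄ = 0 and T₃ = -p⁵. The sum a⁴v₂ = ∑ Tⱼ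
aʲ, j ≤ 3, is a truncation of the generating series 1/(1 - xa + a²), so multiplying by the
denominator telescopes it to 1 - T₄a⁴ + T₃a⁵ = 1 - p⁵a⁵ = 1 - a¹⁰ = 0. -/
theorem vIdeal_le_ker_evalC {a₀ p₀ : ℂ} (ha : a₀ ^ 10 = 1) (hp : p₀ ^ 5 = a₀ ^ 5)
    (h1 : a₀ ≠ p₀) (h2 : a₀ ≠ p₀⁻¹) (h3 : p₀ ≠ 1) (h4 : p₀ ≠ -1)
    (h0 : a₀ ≠ 0) (hx : p₀ + p₀⁻¹ ≠ 0) :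
    vIdeal 5 ≤ RingHom.ker (evalC a₀ (p₀ + p₀⁻¹) h0 hx) := by
  have hp0 : p₀ ≠ 0 := by
    rintro rfl
    exact pow_ne_zero 5 h0 (by simpa using hp.symm)
  have hp10 : p₀ ^ 10 = 1 := by linear_combination (p₀ ^ 5 + a₀ ^ 5) * hp + ha
  have hq : p₀ ^ 2 - 1 ≠ 0 := by
    rw [show p₀ ^ 2 - 1 = (p₀ - 1) * (p₀ + 1) by ring]
    exact mul_ne_zero (sub_ne_zero.2 h3) fun h => h4 (eq_neg_of_add_eq_zero_left h)
  have hT4 : (p₀ + p₀⁻¹) ^ 4 - 3 * (p₀ + p₀⁻¹) ^ 2 + 1 = 0 := by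
    have : (p₀ + p₀⁻¹) ^ 4 - 3 * (p₀ + p₀⁻¹) ^ 2 + 1 =
        (p₀ ^ 10 - 1) / ((p₀ ^ 2 - 1) * p₀ ^ 4) := by
      field_simp
      ring
    rw [this, hp10, sub_self, zero_div]
  have hT3 : (p₀ + p₀⁻¹) ^ 3 - 2 * (p₀ + p₀⁻¹) + p₀ ^ 5 = 0 := by
    have : (p₀ + p₀⁻¹) ^ 3 - 2 * (p₀ + p₀⁻¹) + p₀ ^ 5 =
        (p₀ ^ 10 - 1) / ((p₀ ^ 2 - 1) * p₀ ^ 3) := by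
      field_simp
      ring
    rw [this, hp10, sub_self, zero_div]
  have hv1 : evalC a₀ (p₀ + p₀⁻¹) h0 hx (v1 5) = 0 := by
    simpa only [v1_five, map_add, map_sub, map_mul, map_pow, map_one, map_ofNat, evalC_xVar]
      using hT4
  have hv2 : evalC a₀ (p₀ + p₀⁻¹) h0 hx (v2 5) = 0 := by
    simp only [v2_five, map_add, map_sub, map_mul, map_pow, map_one, map_ofNat, evalC_xVar,
      evalC_aPow, zpow_neg, zpow_one]
    -- This is the factor that telescopes v₂; its roots are the excluded values p₀ and p₀⁻¹ of a₀.
    have hne : a₀ ^ 2 - (p₀ + p₀⁻¹) * a₀ + 1 ≠ 0 := by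
      rw [show a₀ ^ 2 - (p₀ + p₀⁻¹) * a₀ + 1 = (a₀ - p₀) * (a₀ - p₀⁻¹) by
        linear_combination -mul_inv_cancel₀ hp0]
      exact mul_ne_zero (sub_ne_zero.2 h1) (sub_ne_zero.2 h2)
    generalize p₀ + p₀⁻¹ = x at *
    apply mul_left_cancel₀ (mul_ne_zero hne (pow_ne_zero 4 h0))
    have hnum : a₀ ^ 4 * (a₀⁻¹ ^ 4 + x * a₀⁻¹ ^ 3 + (x ^ 2 - 1) * a₀⁻¹ ^ 2 +
        (x ^ 3 - 2 * x) * a₀⁻¹) =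
          1 + x * a₀ + (x ^ 2 - 1) * a₀ ^ 2 + (x ^ 3 - 2 * x) * a₀ ^ 3 := by
      field_simp
    rw [mul_assoc, hnum]
    linear_combination -a₀ ^ 4 * hT4 + a₀ ^ 5 * hT3 - a₀ ^ 5 * hp - ha
  rw [vIdeal, Ideal.span_le]
  rintro _ (rfl | rfl)
  exacts [hv1, hv2]

theorem norm_eq_one_of_pow_ten {a₀ : ℂ} (h : a₀ ^ 10 = 1) : ‖a₀‖ = 1 :=
  Complex.norm_eq_one_of_pow_eq_one h (by norm_num)

/-! ### The substitution `x = a + a⁻¹` -/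

theorem substX_aPow (i : ℤ) :
    substX (aPow i) = algebraMap ℤ[T;T⁻¹] ARing (LaurentPolynomial.T i) := by
  simp [substX, aPow]

theorem substX_xVar : substX xVar = algebraMap ℤ[T;T⁻¹] ARing
    (LaurentPolynomial.T 1 + LaurentPolynomial.T (-1)) := by
  simp [substX, xVar]

theorem five_mem : (5 : ℤ[T;T⁻¹]) ∈ fiveIdeal := Ideal.subset_span (by simp)

theorem sq_sub_one_pow_three_mem : (LaurentPolynomial.T 2 - 1 : ℤ[T;T⁻¹]) ^ 3 ∈ fiveIdeal :=
  Ideal.subset_span (by simp)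

theorem T_two : (LaurentPolynomial.T 2 : ℤ[T;T⁻¹]) = LaurentPolynomial.T 1 ^ 2 := by
  rw [LaurentPolynomial.T_pow]; norm_num

theorem T_one_mul_T_neg_one :
    (LaurentPolynomial.T 1 * LaurentPolynomial.T (-1) : ℤ[T;T⁻¹]) = 1 := by
  rw [← LaurentPolynomial.T_add]; simp

/-- For x = a + a⁻¹ one has aʲTⱼ = 1 + a² + … + a²ʲ. Thus a⁴v₁ = 1 + a² + a⁴ + a⁶ + a⁸ ≡ (a² - 1)⁴
and a⁴v₂ = 4 + 3a² + 2a⁴ + a⁶ ≡ (a² - 1)³ modulo 5. -/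
theorem vIdeal_le_comap_substX :
    vIdeal 5 ≤ (fiveIdeal.map (algebraMap ℤ[T;T⁻¹] ARing)).comap substX := by
  rw [vIdeal, Ideal.span_le]
  have h := T_one_mul_T_neg_one
  have h3 := sq_sub_one_pow_three_mem
  rw [T_two] at h3
  rintro _ (rfl | rfl)
  · have key : substX (v1 5) = algebraMap ℤ[T;T⁻¹] ARing
        ((LaurentPolynomial.T 1 + LaurentPolynomial.T (-1)) ^ 4 -
          3 * (LaurentPolynomial.T 1 + LaurentPolynomial.T (-1)) ^ 2 + 1) := by
      simp only [v1_five, map_add, map_sub, map_mul, map_pow, map_one, map_ofNat, substX_xVar]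
    rw [SetLike.mem_coe, Ideal.mem_comap, key]
    refine Ideal.mem_map_of_mem _ ?_
    clear key
    generalize (LaurentPolynomial.T 1 : ℤ[T;T⁻¹]) = a at *
    generalize (LaurentPolynomial.T (-1) : ℤ[T;T⁻¹]) = b at *
    rw [show (a + b) ^ 4 - 3 * (a + b) ^ 2 + 1 = b ^ 4 * (a ^ 2 - 1) * (a ^ 2 - 1) ^ 3 +
      (b ^ 4 * (a ^ 6 - a ^ 4 + a ^ 2)) * 5 by
        linear_combination (4 * a ^ 2 + 4 * b ^ 2 + 6 * a * b - b ^ 2 * (a * b + 1) -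
          (a ^ 4 + a ^ 2 + 1) * (1 + a * b + (a * b) ^ 2 + (a * b) ^ 3)) * h]
    exact add_mem (Ideal.mul_mem_left _ _ h3) (Ideal.mul_mem_left _ _ five_mem)
  · have key : substX (v2 5) = algebraMap ℤ[T;T⁻¹] ARing
        (LaurentPolynomial.T (-1) ^ 4 +
          (LaurentPolynomial.T 1 + LaurentPolynomial.T (-1)) * LaurentPolynomial.T (-1) ^ 3 +
          ((LaurentPolynomial.T 1 + LaurentPolynomial.T (-1)) ^ 2 - 1) *
            LaurentPolynomial.T (-1) ^ 2 +
          ((LaurentPolynomial.T 1 + LaurentPolynomial.T (-1)) ^ 3 -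
            2 * (LaurentPolynomial.T 1 + LaurentPolynomial.T (-1))) *
              LaurentPolynomial.T (-1)) := by
      simp only [v2_five, map_add, map_sub, map_mul, map_pow, map_one, map_ofNat, substX_xVar,
        substX_aPow]
    rw [SetLike.mem_coe, Ideal.mem_comap, key]
    refine Ideal.mem_map_of_mem _ ?_
    clear key
    generalize (LaurentPolynomial.T 1 : ℤ[T;T⁻¹]) = a at *
    generalize (LaurentPolynomial.T (-1) : ℤ[T;T⁻¹]) = b at *
    rw [show b ^ 4 + (a + b) * b ^ 3 + ((a + b) ^ 2 - 1) * b ^ 2 +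
        ((a + b) ^ 3 - 2 * (a + b)) * b =
      b ^ 4 * (a ^ 2 - 1) ^ 3 + (b ^ 4 * (a ^ 4 + 1)) * 5 by
        linear_combination (6 * b ^ 2 + 4 * a * b + 2 + a ^ 2 - 3 * b ^ 2 * (a * b + 1) -
          (a ^ 2 + 2) * (1 + a * b + (a * b) ^ 2 + (a * b) ^ 3)) * h]
    exact add_mem (Ideal.mul_mem_left _ _ h3) (Ideal.mul_mem_left _ _ five_mem)

/-- `a + a⁻¹` is invertible modulo `(5, (a² - 1)³)`. -/
theorem mem_fiveIdeal_of_mul_mem {P : ℤ[T;T⁻¹]}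
    (h : (LaurentPolynomial.T 1 + LaurentPolynomial.T (-1)) * P ∈ fiveIdeal) :
    P ∈ fiveIdeal := by
  have hab := T_one_mul_T_neg_one
  have h3 := sq_sub_one_pow_three_mem
  rw [T_two] at h3
  generalize (LaurentPolynomial.T 1 : ℤ[T;T⁻¹]) = a at *
  generalize (LaurentPolynomial.T (-1) : ℤ[T;T⁻¹]) = b at *
  -- With u = a² - 1, a(a + a⁻¹) = u + 2 and (u + 2)(u² - 2u + 4) = u³ + 8. Doubling gives 2u³ + 16,
  -- which is 1 modulo 5 and u³.
  rw [show P = 2 * a * ((a ^ 2 - 1) ^ 2 - 2 * (a ^ 2 - 1) + 4) * ((a + b) * P) -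
      (2 * P) * (a ^ 2 - 1) ^ 3 - (3 * P) * 5 by
    linear_combination -2 * P * ((a ^ 2 - 1) ^ 2 - 2 * (a ^ 2 - 1) + 4) * hab]
  exact sub_mem (sub_mem (Ideal.mul_mem_left _ _ h) (Ideal.mul_mem_left _ _ h3))
    (Ideal.mul_mem_left _ _ five_mem)

/-- Membership in the extended ideal means that some power of a + a⁻¹ times P lies in the original
one; the factors are then cancelled one at a time. -/
theorem mem_fiveIdeal_of_algebraMap_mem {P : ℤ[T;T⁻¹]}
    (h : algebraMap ℤ[T;T⁻¹] ARing P ∈ fiveIdeal.map (algebraMap ℤ[T;T⁻¹] ARing)) :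
    P ∈ fiveIdeal := by
  have hloc : IsLocalization.Away
    (LaurentPolynomial.T 1 + LaurentPolynomial.T (-1) : ℤ[T;T⁻¹]) ARing := inferInstance
  obtain ⟨_, ⟨n, rfl⟩, h⟩ := (@IsLocalization.algebraMap_mem_map_algebraMap_iff _ _
    (Submonoid.powers (LaurentPolynomial.T 1 + LaurentPolynomial.T (-1))) ARing _ _ hloc
    fiveIdeal P).1 h
  induction n with
  | zero => simpa using h
  | succ n ih => exact ih (mem_fiveIdeal_of_mul_mem (by rwa [← mul_assoc, ← pow_succ']))

end FiveMove

theorem corollary3p8 (D₁ D₂ : LinkDiagram) (h : MoveEquivalent 5 D₁ D₂) :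
    ((∃ i : ℤ, Lam D₁ - aPow i * Lam D₂ ∈ vIdeal 5) ∧
      ∀ (o₁ : D₁.Orientation) (o₂ : D₂.Orientation),
        ∃ i : ℤ, F o₁ - aPow i * F o₂ ∈ vIdeal 5) ∧
    (∀ (a₀ p₀ : ℂ) (ha : a₀ ^ 10 = 1) (hp : p₀ ^ 5 = a₀ ^ 5),
      a₀ ≠ p₀ → a₀ ≠ p₀⁻¹ → p₀ ≠ 1 → p₀ ≠ -1 →
      ∀ (hI : p₀ ≠ Complex.I) (hI' : p₀ ≠ -Complex.I)
        (o₁ : D₁.Orientation) (o₂ : D₂.Orientation),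
        let ev := evalC a₀ (p₀ + p₀⁻¹) (ne_zero_of_pow_ten ha) (add_inv_ne_zero ha hp hI hI')
        {z : ℂ | ∃ i : ℤ, z = a₀ ^ i * ev (F o₁)} = {z : ℂ | ∃ i : ℤ, z = a₀ ^ i * ev (F o₂)} ∧
          ‖ev (F o₁)‖ = ‖ev (F o₂)‖) ∧
    (∀ (o₁ : D₁.Orientation) (o₂ : D₂.Orientation),
      ∃ i : ℤ,
        substX (F o₁) - substX (aPow i) * substX (F o₂) ∈
            fiveIdeal.map (algebraMap ℤ[T;T⁻¹] ARing) ∧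
          ∀ P₁ P₂ : ℤ[T;T⁻¹], algebraMap ℤ[T;T⁻¹] ARing P₁ = substX (F o₁) →
            algebraMap ℤ[T;T⁻¹] ARing P₂ = substX (F o₂) →
              P₁ - LaurentPolynomial.T i * P₂ ∈ fiveIdeal) := by
  refine ⟨⟨lam_congr h, F_congr h⟩, ?_, ?_⟩
  · intro a₀ p₀ ha hp h1 h2 h3 h4 hI hI' o₁ o₂ ev
    obtain ⟨i, hi⟩ := F_congr h o₁ o₂
    have ha0 := ne_zero_of_pow_ten ha
    have hev : ev (F o₁) = a₀ ^ i * ev (F o₂) := by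
      have := vIdeal_le_ker_evalC ha hp h1 h2 h3 h4 ha0 (add_inv_ne_zero ha hp hI hI') hi
      rwa [RingHom.mem_ker, map_sub, map_mul, evalC_aPow, sub_eq_zero] at this
    refine ⟨?_, by rw [hev, norm_mul, norm_zpow, norm_eq_one_of_pow_ten ha, one_zpow, one_mul]⟩
    ext z
    constructor
    · rintro ⟨j, rfl⟩
      exact ⟨j + i, by rw [hev, zpow_add₀ ha0, mul_assoc]⟩
    · rintro ⟨j, rfl⟩
      exact ⟨j - i, by rw [hev, ← mul_assoc, ← zpow_add₀ ha0, sub_add_cancel]⟩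
  · intro o₁ o₂
    obtain ⟨i, hi⟩ := F_congr h o₁ o₂
    have hs := vIdeal_le_comap_substX hi
    rw [Ideal.mem_comap, map_sub, map_mul] at hs
    refine ⟨i, hs, fun P₁ P₂ h₁ h₂ => mem_fiveIdeal_of_algebraMap_mem ?_⟩
    rwa [map_sub, map_mul, h₁, h₂, ← substX_aPow]
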